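/- Let $p$ be a prime, $K$ a finite extension of $\mathbb{Q}_p$ with valuation ring $\mathcal{O}_K$, and let $\alpha_1,\dots,\alpha_d\in\mathcal{O}_K$ be a basis of $K$ over $\mathbb{Q}_p$ which is also a basis of $\mathcal{O}_K$ over $\mathbb{Z}_p$. Let $\mathcal{O}_K\{X_1,\dots,X_m\}$ denote the ring of power series with coefficients in $\mathcal{O}_K$ tending to $0$, and let $F\subseteq\bigcup_{m}\mathcal{O}_K\{X_1,\dots,X_m\}$. Let $\mathcal{L}_F$ be the first-order language with function symbols $+,-,\cdot$, constants $0,1,\alpha_1,\dots,\alpha_d$, a unary predicate $P_k$ for each $k\in\mathbb{N}$, and an $m$-ary function symbol for every $f\in F$ in $m$ variables. Interpret it in $\mathcal{O}_K$ in the natural way: $P_k$ is the set of $k$-th powers, and $f\in F$ is the function $\mathcal{O}_K^m\to\mathcal{O}_K$ given by the sum of the series. Thus an $\mathcal{L}_F$-term in the variables $x_1,\dots,x_n$ defines a function $\mathcal{O}_K^n\to\mathcal{O}_K$. Assume that: 1. the set of $\mathcal{L}_F$-terms is closed under derivation, i.e. for all $n$, every partial derivative of (the function defined by) an $\mathcal{L}_F$-term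 in $x_1,\dots,x_n$ is again defined by an $\mathcal{L}_F$-term in $x_1,\dots,x_n$; 2. for all $n$ and every finite set of $\mathcal{L}_F$-terms in $x_1,\dots,x_n$, the ring of functions on $\mathcal{O}_K^n$ generated by these terms, their subterms, and the partial derivatives of all orders of these is Noetherian. Let $f$ be an $\mathcal{L}_F$-term in the variables $x_1,\dots,x_n$ such that $f(\overline{x})=0$ for some $\overline{x}\in\mathcal{O}_K^n$. Then there are $\mathcal{L}_F$-terms $f_1,\dots,f_n$ in the variables $x_1,\dots,x_n$ and a point $\overline{x}\in\mathcal{O}_K^n$ such that $$f(\overline{x})=f_1(\overline{x})=\cdots=f_n(\overline{x})=0\neq\det J_{(f_1,\dots,f_n)}(\overline{x}),$$ where $J_{(f_1,\dots,f_n)}=(\partial f_i/\partial x_j)_{1\le i,j\le n}$ is the Jacobian matrix. -/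

import Mathlib

open FirstOrder Filter Topology

/-- The valuation ring `𝒪_K = {x ∈ K : |x| ≤ 1}` of a nonarchimedean normed field `K`. -/
noncomputable abbrev ValRing (K : Type*) [NormedField K] [IsUltrametricDist K] : Subring K :=
  (NormedField.valuation (K := K)).integer

/-- `𝒪_K{X_1, …, X_m}`: the power series over `𝒪_K` whose coefficients tend to `0`. -/
abbrev ConvSeries (K : Type*) [NormedField K] [IsUltrametricDist K] (m : ℕ) : Type _ :=
  {f : MvPowerSeries (Fin m) (ValRing K) // MvPowerSeries.IsRestricted (fun _ => (1 : ℝ)) f}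

/-- The value in `𝒪_K` of a convergent power series at a point of `𝒪_K^m`. -/
noncomputable def ConvSeries.eval {K : Type*} [NormedField K] [IsUltrametricDist K] {m : ℕ}
    (f : ConvSeries K m) (x : Fin m → ValRing K) : ValRing K :=
  ∑' e : Fin m →₀ ℕ, MvPowerSeries.coeff e f.1 * e.prod (fun i k => x i ^ k)

/-- The elements `α_1, …, α_d` of `𝒪_K` form a basis of `K` over `ℚ_p` which is also a basis of
`𝒪_K` over `ℤ_p`. -/
def IsIntegralBasis (p : ℕ) [Fact p.Prime] {K : Type*} [NormedField K] [IsUltrametricDist K]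
    [NormedAlgebra ℚ_[p] K] {d : ℕ} (α : Fin d → ValRing K) : Prop :=
  ∃ b : Module.Basis (Fin d) ℚ_[p] K,
    (∀ i, b i = (α i : K)) ∧ ∀ (x : ValRing K) (i : Fin d), ‖b.repr (x : K) i‖ ≤ 1

/-- Function symbols of `L_F`: the ring operations, constants `α_1, …, α_d`, and one `m`-ary symbol
for each `f ∈ F` in `m` variables. -/
inductive FunSymb {K : Type*} [NormedField K] [IsUltrametricDist K]
    (F : (m : ℕ) → Set (ConvSeries K m)) {d : ℕ} (α : Fin d → ValRing K) : ℕ → Type _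
  | zero : FunSymb F α 0
  | one : FunSymb F α 0
  | neg : FunSymb F α 1
  | add : FunSymb F α 2
  | mul : FunSymb F α 2
  | const (i : Fin d) : FunSymb F α 0
  | series {m : ℕ} (f : F m) : FunSymb F α m

/-- Relation symbols of `L_F`: the unary predicates `P_n`, `n ∈ ℕ`. -/
inductive RelSymb : ℕ → Type
  | power (n : ℕ) : RelSymb 1

/-- The language `L_F` (with the constants `α_1, …, α_d`). -/
def LangF {K : Type*} [NormedField K] [IsUltrametricDist K]
    (F : (m : ℕ) → Set (ConvSeries K m)) {d : ℕ} (α : Fin d → ValRing K) : Language where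
  Functions := FunSymb F α
  Relations := RelSymb

/-- Interpretation of the function symbols in `𝒪_K`. -/
noncomputable def FunSymb.interp {K : Type*} [NormedField K] [IsUltrametricDist K]
    {F : (m : ℕ) → Set (ConvSeries K m)} {d : ℕ} {α : Fin d → ValRing K} :
    {m : ℕ} → FunSymb F α m → (Fin m → ValRing K) → ValRing K
  | _, .zero, _ => 0
  | _, .one, _ => 1
  | _, .neg, x => -x 0
  | _, .add, x => x 0 + x 1
  | _, .mul, x => x 0 * x 1
  | _, .const i, _ => α i
  | _, .series f, x => ConvSeries.eval f.1 x

/-- Interpretation of the predicate `P_n` in `𝒪_K`: the set of `n`-th powers. -/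
def RelSymb.interp {K : Type*} [NormedField K] [IsUltrametricDist K] :
    {m : ℕ} → RelSymb m → (Fin m → ValRing K) → Prop
  | _, .power n, x => ∃ y : ValRing K, y ^ n = x 0

/-- `𝒪_K` as an `L_F`-structure. -/
noncomputable instance valRingStructure {K : Type*} [NormedField K] [IsUltrametricDist K]
    (F : (m : ℕ) → Set (ConvSeries K m)) {d : ℕ} (α : Fin d → ValRing K) :
    (LangF F α).Structure (ValRing K) where
  funMap f x := FunSymb.interp f x
  RelMap r x := RelSymb.interp r x

/-- The set of subterms of a term (including the term itself). -/
def subterms {L : Language} {β : Type*} : L.Term β → Set (L.Term β)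
  | .var a => {.var a}
  | .func f ts => insert (.func f ts) (⋃ i, subterms (ts i))

open Classical in
/-- For `g : 𝒪_K^n → 𝒪_K`, the function `t ↦ g(x_1, …, x_{i-1}, t, x_{i+1}, …, x_n)` of one variable
`t ∈ K`, extended by `0` outside the open set `𝒪_K`. -/
noncomputable def coordSlice {K : Type*} [NormedField K] [IsUltrametricDist K] {n : ℕ}
    (g : (Fin n → ValRing K) → ValRing K) (i : Fin n) (x : Fin n → ValRing K) (t : K) : K :=
  if h : t ∈ ValRing K then (g (Function.update x i ⟨t, h⟩) : K) else 0

/-- On `𝒪_K^n`, the function `g` has the partial derivative `h` with respect to `x_i`. -/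
def HasPartialDeriv {K : Type*} [NontriviallyNormedField K] [IsUltrametricDist K] {n : ℕ}
    (i : Fin n) (g h : (Fin n → ValRing K) → ValRing K) : Prop :=
  ∀ x, HasDerivAt (coordSlice g i x) (h x : K) (x i : K)

/-- `IsIterDeriv g h`: the function `h` is an iterated partial derivative of `g`, of some order
`≥ 0`. -/
inductive IsIterDeriv {K : Type*} [NontriviallyNormedField K] [IsUltrametricDist K] {n : ℕ}
    (g : (Fin n → ValRing K) → ValRing K) : ((Fin n → ValRing K) → ValRing K) → Prop
  | refl : IsIterDeriv g g
  | step {h h' : (Fin n → ValRing K) → ValRing K} (i : Fin n) :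
      IsIterDeriv g h → HasPartialDeriv i h h' → IsIterDeriv g h'

/-- The Jacobian matrix `(∂f_i/∂x_j)(x)` of `f_1, …, f_n : 𝒪_K^n → 𝒪_K` at a point. -/
noncomputable def jacobian {K : Type*} [NontriviallyNormedField K] [IsUltrametricDist K] {n : ℕ}
    (f : Fin n → (Fin n → ValRing K) → ValRing K) (x : Fin n → ValRing K) :
    Matrix (Fin n) (Fin n) K :=
  Matrix.of fun i j => deriv (coordSlice (f i) j x) (x j : K)

/-- The function `𝒪_K^n → 𝒪_K` defined by an `L_F`-term in the variables `x_1, …, x_n`. -/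
noncomputable def termFun {K : Type*} [NormedField K] [IsUltrametricDist K]
    {F : (m : ℕ) → Set (ConvSeries K m)} {d : ℕ} {α : Fin d → ValRing K} {n : ℕ}
    (t : (LangF F α).Term (Fin n)) (x : Fin n → ValRing K) : ValRing K :=
  t.realize x

/-- The set of `L_F`-terms is closed under derivation. -/
def ClosedUnderDerivation {K : Type*} [NontriviallyNormedField K] [IsUltrametricDist K]
    (F : (m : ℕ) → Set (ConvSeries K m)) {d : ℕ} (α : Fin d → ValRing K) : Prop :=
  ∀ (n : ℕ) (t : (LangF F α).Term (Fin n)) (i : Fin n),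
    ∃ t' : (LangF F α).Term (Fin n), HasPartialDeriv i (termFun t) (termFun t')

/-- The ring of functions on `𝒪_K^n` generated by the terms in `T`, their subterms, and all the
iterated partial derivatives of these. -/
noncomputable def termRing {K : Type*} [NontriviallyNormedField K] [IsUltrametricDist K]
    {F : (m : ℕ) → Set (ConvSeries K m)} {d : ℕ} {α : Fin d → ValRing K} {n : ℕ}
    (T : Set ((LangF F α).Term (Fin n))) : Subring ((Fin n → ValRing K) → ValRing K) :=
  Subring.closure {h | ∃ t ∈ T, ∃ s ∈ subterms t, IsIterDeriv (termFun s) h}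

/-! Let A be the ring of functions on 𝒪_K^n defined by terms. It is closed under the ∂_j, and its
members are analytic at every point of the polydisc (`analyticAt_zeroExt_termFun`). Fix a zero P of
f and let V be the span of the gradients at P of the members of A vanishing at P. Choose such
members h_i, i ∈ S, whose gradients form a basis of V, and complete them by coordinate functions to
local analytic coordinates h_1, …, h_n at P (`exists_basis_completion`, `exists_analytic_inverse`).

The crux is `eventually_eq_zero_of_gradient_mem_span`: every g ∈ A with g(P) = 0 vanishes near P on
the submanifold Z given by h_i = 0, i ∈ S. With J the Jacobian matrix of h, the vector field det J ·
∂/∂h_k has coefficients in the adjugate of J, so it maps A to A. For k ∉ S it annihilates V at P,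
hence preserves the ideal of functions in A vanishing at P. So all iterated derivatives of g along Z
vanish at P; in characteristic zero this forces g = 0 on Z near P.

Thus f vanishes on Z near P, and P may be moved inside Z. This is needed because the values h_i(P),
i ∉ S, need not be given by terms. These h_i are free coordinates on Z, and the integer combinations
of the α_j are dense in 𝒪_K, so some x ∈ Z near P has h_i(x) = a_i with a_i such a constant. The
functions h_i (i ∈ S) and h_i - a_i (i ∉ S) vanish at x, and their Jacobian there is that of h,
nonzero by continuity. -/

/-! ### Analyticity of restricted power series on the closed polydisc -/

/-- A product of powers of the coordinates is the diagonal of a continuous multilinear map of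
norm at most one. -/
lemma exists_multilinear_monomial {K : Type*} [NontriviallyNormedField K] {m : ℕ} (N : ℕ)
    (k : Fin m → ℕ) (hk : ∑ i, k i = N) :
    ∃ M : ContinuousMultilinearMap K (fun _ : Fin N => Fin m → K) K,
      (∀ v, ‖M v‖ ≤ ∏ j, ‖v j‖) ∧ ∀ y : Fin m → K, M (fun _ => y) = ∏ i, y i ^ k i := by
  subst hk
  refine ⟨(ContinuousMultilinearMap.mkPiAlgebra K (Fin (∑ i, k i)) K).compContinuousLinearMap
    fun j => ContinuousLinearMap.proj (finSigmaFinEquiv.symm j).1, fun v => ?_, fun y => ?_⟩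
  · simp only [ContinuousMultilinearMap.compContinuousLinearMap_apply,
      ContinuousMultilinearMap.mkPiAlgebra_apply, ContinuousLinearMap.proj_apply, norm_prod]
    exact Finset.prod_le_prod (fun _ _ => norm_nonneg _) fun j _ => norm_le_pi_norm (v j) _
  · simp only [ContinuousMultilinearMap.compContinuousLinearMap_apply,
      ContinuousMultilinearMap.mkPiAlgebra_apply, ContinuousLinearMap.proj_apply]
    rw [Equiv.prod_comp finSigmaFinEquiv.symm (fun s : (i : Fin m) × Fin (k i) => y s.1),
      Fintype.prod_sigma]
    simp

/-- The sum of a restricted power series is analytic at each point of the closed unit polydisc. -/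
lemma analyticAt_of_hasSum_restricted {K : Type*} [NontriviallyNormedField K] [IsUltrametricDist K]
    [CompleteSpace K] {m : ℕ} {a : (Fin m →₀ ℕ) → K} (ha : Tendsto a cofinite (𝓝 0))
    {g : (Fin m → K) → K}
    (hg : ∀ x : Fin m → K, (∀ i, ‖x i‖ ≤ 1) → HasSum (fun e => a e * ∏ i, x i ^ e i) (g x))
    {x₀ : Fin m → K} (hx₀ : ∀ i, ‖x₀ i‖ ≤ 1) : AnalyticAt K g x₀ := by
  classical
  obtain ⟨C, hC⟩ : ∃ C : ℝ, ∀ e, ‖a e‖ ≤ C := by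
    have := (ha.norm).bddAbove_range_of_cofinite
    obtain ⟨C, hC⟩ := this
    exact ⟨C, fun e => hC ⟨e, rfl⟩⟩
  have hC0 : 0 ≤ C := (norm_nonneg _).trans (hC 0)
  -- The coefficient of y^k in a_e (x₀ + y)^e. The truncated subtraction is harmless: the binomial
  -- coefficient is zero when k_i > e_i.
  let G : (Fin m →₀ ℕ) × (Fin m → ℕ) → K := fun q =>
    a q.1 * ∏ i, ((q.1 i).choose (q.2 i) * x₀ i ^ (q.1 i - q.2 i))
  have hGa : ∀ q, ‖G q‖ ≤ ‖a q.1‖ := by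
    intro q
    simp only [G, norm_mul, norm_prod, norm_pow]
    refine mul_le_of_le_one_right (norm_nonneg _) (Finset.prod_le_one (fun _ _ => by positivity) ?_)
    intro i _
    exact mul_le_one₀ (IsUltrametricDist.norm_natCast_le_one K _) (by positivity)
      (pow_le_one₀ (norm_nonneg _) (hx₀ i))
  have hG0 : Tendsto G cofinite (𝓝 0) := by
    rw [Metric.tendsto_nhds] at ha ⊢
    intro ε hε
    have hfin := ha ε hε
    rw [eventually_cofinite] at hfin ⊢
    refine Set.Finite.subset (hfin.biUnion fun e _ =>
      (Set.finite_singleton e).prod (Set.finite_Iic (⇑e : Fin m → ℕ))) ?_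
    rintro ⟨e, k⟩ hq
    simp only [Set.mem_ofPred_eq, dist_zero_right, not_lt] at hq
    simp only [Set.mem_iUnion, Set.mem_ofPred_eq, dist_zero_right, not_lt]
    refine ⟨e, hq.trans (hGa _), by simp, ?_⟩
    by_contra hk
    simp only [Set.mem_Iic, Pi.le_def, not_forall, not_le] at hk
    obtain ⟨i, hi⟩ := hk
    have : G (e, k) = 0 := by
      simp only [G]
      rw [Finset.prod_eq_zero (Finset.mem_univ i), mul_zero]
      simp [Nat.choose_eq_zero_of_lt hi]
    rw [this, norm_zero] at hq
    exact absurd hq (not_le.2 hε)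
  -- Taylor coefficients at x₀; the ultrametric inequality bounds them by C, so the expansion
  -- converges on the open unit ball.
  let b : (Fin m → ℕ) → K := fun k => ∑' e, G (e, k)
  have hb : ∀ k, ‖b k‖ ≤ C := fun k =>
    IsUltrametricDist.norm_tsum_le_of_forall_le_of_nonneg hC0 fun e => (hGa _).trans (hC e)
  have hbs : ∀ k, HasSum (fun e => G (e, k)) (b k) := fun k =>
    (NonarchimedeanAddGroup.summable_of_tendsto_cofinite_zero
      (hG0.comp (Prod.mk_left_injective k).tendsto_cofinite)).hasSum
  have hM := fun (N : ℕ) (k : Fin m → ℕ) => exists_multilinear_monomial (K := K) (m := m) N k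
  let M : (N : ℕ) → (Fin m → ℕ) → ContinuousMultilinearMap K (fun _ : Fin N => Fin m → K) K :=
    fun N k => if h : ∑ i, k i = N then (hM N k h).choose else 0
  have hM1 : ∀ N k v, ‖M N k v‖ ≤ ∏ j, ‖v j‖ := by
    intro N k v
    by_cases h : ∑ i, k i = N
    · simp only [M, dif_pos h]
      exact (hM N k h).choose_spec.1 v
    · simp only [M, dif_neg h, zero_apply, norm_zero]
      positivity
  have hM2 : ∀ N k, ∑ i, k i = N → ∀ y, M N k (fun _ => y) = ∏ i, y i ^ k i := by
    intro N k h y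
    simp only [M, dif_pos h]
    exact (hM N k h).choose_spec.2 y
  let P : FormalMultilinearSeries K (Fin m → K) K := fun N =>
    ∑ k ∈ Finset.piAntidiag Finset.univ N, b k • M N k
  have hP : ∀ N, ‖P N‖ ≤ C := by
    intro N
    refine ContinuousMultilinearMap.opNorm_le_bound hC0 fun v => ?_
    simp only [P, sum_apply, smul_apply]
    refine IsUltrametricDist.norm_sum_le_of_forall_le_of_nonneg (by positivity) fun k _ => ?_
    rw [norm_smul]
    exact mul_le_mul (hb k) (hM1 N k v) (norm_nonneg _) hC0
  refine ⟨P, 1, ?_, one_pos, ?_⟩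
  · exact P.le_radius_of_bound C fun N => by simpa using hP N
  · intro y hy
    have hy1 : ∀ i, ‖y i‖ ≤ 1 := by
      intro i
      have : ‖y‖ < 1 := by simpa [← ofReal_norm] using hy
      exact (norm_le_pi_norm y i).trans this.le
    have hym : ∀ k : Fin m → ℕ, ‖∏ i, y i ^ k i‖ ≤ 1 := by
      intro k
      rw [norm_prod]
      refine Finset.prod_le_one (fun _ _ => norm_nonneg _) fun i _ => ?_
      rw [norm_pow]
      exact pow_le_one₀ (norm_nonneg _) (hy1 i)
    have hsum : Summable fun q => G q * ∏ i, y i ^ q.2 i := by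
      refine NonarchimedeanAddGroup.summable_of_tendsto_cofinite_zero ?_
      refine squeeze_zero_norm (fun q => ?_) (tendsto_norm_zero.comp hG0)
      rw [norm_mul]
      exact mul_le_of_le_one_right (norm_nonneg _) (hym _)
    have h1 : ∀ e : Fin m →₀ ℕ, HasSum (fun k => G (e, k) * ∏ i, y i ^ k i)
        (a e * ∏ i, (x₀ + y) i ^ e i) := by
      intro e
      have : a e * ∏ i, (x₀ + y) i ^ e i =
          ∑ k ∈ Fintype.piFinset fun i => Finset.range (e i + 1), G (e, k) * ∏ i, y i ^ k i := by
        simp only [G, Pi.add_apply, mul_assoc, ← Finset.mul_sum, ← Finset.prod_mul_distrib]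
        rw [← Finset.prod_univ_sum (fun i => Finset.range (e i + 1)) fun i l =>
          ((e i).choose l * (x₀ i ^ (e i - l) * y i ^ l) : K)]
        congr 1
        refine Finset.prod_congr rfl fun i _ => ?_
        rw [add_comm, add_pow]
        exact Finset.sum_congr rfl fun l _ => by ring
      rw [this]
      refine hasSum_sum_of_ne_finset_zero fun k hk => ?_
      simp only [Fintype.mem_piFinset, Finset.mem_range, not_forall, not_lt] at hk
      obtain ⟨i, hi⟩ := hk
      simp only [G]
      rw [Finset.prod_eq_zero (Finset.mem_univ i), mul_zero, zero_mul]
      simp [Nat.choose_eq_zero_of_lt (Nat.lt_of_succ_le hi)]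
    have hxy : ∀ i, ‖(x₀ + y) i‖ ≤ 1 := fun i =>
      (IsUltrametricDist.norm_add_le_max _ _).trans (max_le (hx₀ i) (hy1 i))
    -- The double family is summable, so it may be summed over k first, giving g(x₀ + y), or over e
    -- first, giving the Taylor expansion, which is then grouped by total degree.
    have h2 : HasSum (fun q => G q * ∏ i, y i ^ q.2 i) (g (x₀ + y)) := by
      have := hsum.hasSum.prod_fiberwise h1
      rw [← this.unique (hg _ hxy)]
      exact hsum.hasSum
    have h3 : HasSum (fun k => b k * ∏ i, y i ^ k i) (g (x₀ + y)) :=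
      ((Equiv.prodComm _ _).hasSum_iff.2 h2).prod_fiberwise fun k => (hbs k).mul_right _
    convert h3.tsum_fiberwise (fun k => ∑ i, k i) using 2 with N
    have hset : (fun k : Fin m → ℕ => ∑ i, k i) ⁻¹' {N} =
        ↑(Finset.piAntidiag (Finset.univ : Finset (Fin m)) N) := by
      ext k
      simp
    rw [hset, Finset.tsum_subtype' (Finset.piAntidiag Finset.univ N)
      fun k => b k * ∏ i, y i ^ k i]
    simp only [P, sum_apply, smul_apply]
    refine Finset.sum_congr rfl fun k hk => ?_
    rw [hM2 N k (by simpa using hk), smul_eq_mul]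

/-! ### Extension by zero, and analyticity of terms -/

lemma mem_valRing_iff {K : Type*} [NormedField K] [IsUltrametricDist K] {x : K} :
    x ∈ ValRing K ↔ ‖x‖ ≤ 1 := by
  rw [Valuation.mem_integer_iff, ← NNReal.coe_le_coe]
  rfl

/-- By the ultrametric inequality the polydisc is open, so extension by zero does not affect germs
at its points. -/
lemma eventually_mem_valRing {K : Type*} [NormedField K] [IsUltrametricDist K] {n : ℕ}
    (x : Fin n → ValRing K) : ∀ᶠ z : Fin n → K in 𝓝 (fun i => (x i : K)), ∀ i, z i ∈ ValRing K := by
  filter_upwards [Metric.ball_mem_nhds (fun i => (x i : K)) one_pos] with z hz i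
  rw [mem_valRing_iff]
  have h1 : ‖z i - x i‖ ≤ 1 :=
    (norm_le_pi_norm (z - fun i => (x i : K)) i).trans (mem_ball_iff_norm.1 hz).le
  have h2 := IsUltrametricDist.norm_add_le_max (z i - x i) (x i : K)
  rw [sub_add_cancel] at h2
  exact h2.trans (max_le h1 (mem_valRing_iff.1 (x i).2))

open Classical in
/-- The extension by zero to `K^n` of a function `𝒪_K^n → 𝒪_K`. -/
noncomputable def zeroExt {K : Type*} [NormedField K] [IsUltrametricDist K] {n : ℕ}
    (g : (Fin n → ValRing K) → ValRing K) (z : Fin n → K) : K :=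
  if h : ∀ i, z i ∈ ValRing K then (g fun i => ⟨z i, h i⟩ : K) else 0

lemma zeroExt_coe {K : Type*} [NormedField K] [IsUltrametricDist K] {n : ℕ}
    (g : (Fin n → ValRing K) → ValRing K) (x : Fin n → ValRing K) :
    zeroExt g (fun i => (x i : K)) = g x := by
  simp [zeroExt]

lemma zeroExt_of_mem {K : Type*} [NormedField K] [IsUltrametricDist K] {n : ℕ}
    (g : (Fin n → ValRing K) → ValRing K) {z : Fin n → K} (h : ∀ i, z i ∈ ValRing K) :
    zeroExt g z = g fun i => ⟨z i, h i⟩ :=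
  dif_pos h

lemma coordSlice_eq_zeroExt {K : Type*} [NormedField K] [IsUltrametricDist K] {n : ℕ}
    (g : (Fin n → ValRing K) → ValRing K) (i : Fin n) (x : Fin n → ValRing K) (t : K) :
    coordSlice g i x t = zeroExt g (Function.update (fun j => (x j : K)) i t) := by
  by_cases h : t ∈ ValRing K
  · have : Function.update (fun j => (x j : K)) i t =
        fun j => ((Function.update x i ⟨t, h⟩ : Fin n → ValRing K) j : K) := by
      ext j
      by_cases hj : j = i
      · subst hj
        simp
      · simp [hj]
    rw [this, zeroExt_coe, coordSlice, dif_pos h]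
  · rw [coordSlice, dif_neg h, zeroExt, dif_neg]
    intro h'
    exact h (by simpa using h' i)

lemma analyticAt_zeroExt_convSeries {K : Type*} [NontriviallyNormedField K] [IsUltrametricDist K]
    [CompleteSpace K] {m : ℕ} (f : ConvSeries K m) (x : Fin m → ValRing K) :
    AnalyticAt K (zeroExt f.eval) (fun i => (x i : K)) := by
  have ha : Tendsto (fun e => ((MvPowerSeries.coeff e f.1 : ValRing K) : K)) cofinite (𝓝 0) := by
    have := f.2
    simp only [MvPowerSeries.IsRestricted, one_pow, Finsupp.prod_fun_one, mul_one] at this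
    exact tendsto_zero_iff_norm_tendsto_zero.2 this
  have hclosed : IsClosed (ValRing K : Set K) := by
    have : (ValRing K : Set K) = {z | ‖z‖ ≤ 1} := Set.ext fun _ => mem_valRing_iff
    rw [this]
    exact isClosed_le continuous_norm continuous_const
  refine analyticAt_of_hasSum_restricted ha (fun z hz => ?_) fun i => mem_valRing_iff.1 (x i).2
  have hz' : ∀ i, z i ∈ ValRing K := fun i => mem_valRing_iff.2 (hz i)
  rw [zeroExt_of_mem _ hz']
  have hs : Summable fun e : Fin m →₀ ℕ => ((MvPowerSeries.coeff e f.1 : ValRing K) : K) * ∏ i, z i ^ e i := by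
    refine NonarchimedeanAddGroup.summable_of_tendsto_cofinite_zero ?_
    refine squeeze_zero_norm (fun e => ?_) (tendsto_norm_zero.comp ha)
    rw [norm_mul, norm_prod]
    refine mul_le_of_le_one_right (norm_nonneg _)
      (Finset.prod_le_one (fun _ _ => norm_nonneg _) fun i _ => ?_)
    rw [norm_pow]
    exact pow_le_one₀ (norm_nonneg _) (hz i)
  have hcoe : ∀ e : Fin m →₀ ℕ, ((MvPowerSeries.coeff e f.1 : ValRing K) : K) * ∏ i, z i ^ e i =
      ((MvPowerSeries.coeff e f.1 * e.prod (fun i k => (⟨z i, hz' i⟩ : ValRing K) ^ k) :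
        ValRing K) : K) := by
    intro e
    rw [Finsupp.prod_fintype _ _ fun i => pow_zero _]
    simp
  -- The series is summed in K, while `ConvSeries.eval` sums in 𝒪_K; the two agree because 𝒪_K is
  -- closed in K.
  have hmem : ∑' e : Fin m →₀ ℕ, ((MvPowerSeries.coeff e f.1 : ValRing K) : K) * ∏ i, z i ^ e i ∈ ValRing K := by
    refine hclosed.mem_of_tendsto hs.hasSum (Eventually.of_forall fun s => ?_)
    simp only [hcoe]
    exact sum_mem fun e _ => Subtype.property _
  have hO : HasSum (fun e : Fin m →₀ ℕ => MvPowerSeries.coeff e f.1 *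
      e.prod (fun i k => (⟨z i, hz' i⟩ : ValRing K) ^ k)) ⟨_, hmem⟩ := by
    refine (Topology.IsInducing.hasSum_iff (g := (ValRing K).subtype) Topology.IsInducing.subtypeVal _ _).1 ?_
    exact hs.hasSum.congr_fun fun e => (hcoe e).symm
  rw [ConvSeries.eval, hO.tsum_eq]
  exact hs.hasSum

lemma analyticAt_zeroExt_termFun {K : Type*} [NontriviallyNormedField K] [IsUltrametricDist K]
    [CompleteSpace K] {F : (m : ℕ) → Set (ConvSeries K m)} {d : ℕ} {α : Fin d → ValRing K} {n : ℕ}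
    (t : (LangF F α).Term (Fin n)) (x : Fin n → ValRing K) :
    AnalyticAt K (zeroExt (termFun t)) (fun i => (x i : K)) := by
  induction t with
  | var i =>
    have h : AnalyticAt K (fun z : Fin n → K => z i) (fun i => (x i : K)) :=
      (ContinuousLinearMap.proj (R := K) (φ := fun _ : Fin n => K) i).analyticAt _
    refine h.congr ?_
    filter_upwards [eventually_mem_valRing x] with z hz
    simp [zeroExt_of_mem _ hz, termFun]
  | @func l s ts ih =>
    -- By composition it suffices that the interpretation of each function symbol extends to a map
    -- analytic at the point in question.
    have key : ∀ G : (Fin l → K) → K,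
        AnalyticAt K G (fun j => (termFun (ts j) x : K)) →
        (∀ y : Fin l → ValRing K, G (fun j => (y j : K)) = (FunSymb.interp s y : K)) →
        AnalyticAt K (zeroExt (termFun (Language.Term.func s ts))) (fun i => (x i : K)) := by
      intro G hG hGs
      have hH : AnalyticAt K (fun z j => zeroExt (termFun (ts j)) z) (fun i => (x i : K)) :=
        AnalyticAt.pi ih
      have hG' : AnalyticAt K G ((fun z j => zeroExt (termFun (ts j)) z) fun i => (x i : K)) := by
        simpa only [zeroExt_coe] using hG
      refine (hG'.comp hH).congr ?_
      filter_upwards [eventually_mem_valRing x] with z hz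
      simp only [Function.comp, zeroExt_of_mem _ hz, hGs]
      rfl
    have hpr : ∀ (j : Fin l) (w : Fin l → K), AnalyticAt K (fun z : Fin l → K => z j) w :=
      fun j w => (ContinuousLinearMap.proj (R := K) (φ := fun _ : Fin l => K) j).analyticAt w
    cases s with
    | zero => exact key (fun _ => 0) analyticAt_const fun y => rfl
    | one => exact key (fun _ => 1) analyticAt_const fun y => rfl
    | const i => exact key (fun _ => α i) analyticAt_const fun y => rfl
    | neg => exact key (fun z => -z 0) (hpr 0 _).neg fun y => rfl
    | add => exact key (fun z => z 0 + z 1) ((hpr 0 _).add (hpr 1 _)) fun y => rfl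
    | mul => exact key (fun z => z 0 * z 1) ((hpr 0 _).mul (hpr 1 _)) fun y => rfl
    | series f =>
      exact key (zeroExt f.1.eval) (analyticAt_zeroExt_convSeries f.1 _) fun y => zeroExt_coe _ y

/-! ### Gradients, orders of vanishing and local coordinates -/

/-- A partial derivative of `g` is the value of the Fréchet derivative of its extension at a
coordinate vector. -/
lemma hasDerivAt_coordSlice {K : Type*} [NontriviallyNormedField K] [IsUltrametricDist K] {n : ℕ}
    {g : (Fin n → ValRing K) → ValRing K} {x : Fin n → ValRing K}
    (hg : AnalyticAt K (zeroExt g) (fun i => (x i : K))) (i : Fin n) :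
    HasDerivAt (coordSlice g i x) (fderiv K (zeroExt g) (fun i => (x i : K)) (Pi.single i 1))
      (x i : K) := by
  have h1 := hasDerivAt_update (fun j => (x j : K)) i (x i : K)
  have h2 := hg.differentiableAt.hasFDerivAt
  have h3 : HasFDerivAt (zeroExt g) (fderiv K (zeroExt g) (fun i => (x i : K)))
      (Function.update (fun j => (x j : K)) i (x i : K)) := by simpa using h2
  refine (h3.comp_hasDerivAt _ h1).congr_of_eventuallyEq (Eventually.of_forall fun t => ?_)
  exact coordSlice_eq_zeroExt g i x t

/-- The gradient at a point of `𝒪_K^n` of a function `𝒪_K^n → 𝒪_K`. -/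
noncomputable def gradAt {K : Type*} [NontriviallyNormedField K] [IsUltrametricDist K] {n : ℕ}
    (g : (Fin n → ValRing K) → ValRing K) (x : Fin n → ValRing K) (j : Fin n) : K :=
  fderiv K (zeroExt g) (fun i => (x i : K)) (Pi.single j 1)

lemma clm_apply_eq_dotProduct {K : Type*} [NontriviallyNormedField K] {n : ℕ}
    (L : (Fin n → K) →L[K] K) (w : Fin n → K) : L w = (fun j => L (Pi.single j 1)) ⬝ᵥ w := by
  have : w = ∑ j, w j • Pi.single (M := fun _ => K) j 1 := by
    ext i
    simp [Finset.sum_apply, Pi.single_apply]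
  conv_lhs => rw [this]
  simp [dotProduct, mul_comm]

lemma natCast_le_analyticOrderAt_sum {K : Type*} [NontriviallyNormedField K] {ι : Type*}
    (s : Finset ι) (q : ι → K → K) (z : K) (N : ℕ∞)
    (h : ∀ k ∈ s, N ≤ analyticOrderAt (q k) z) :
    N ≤ analyticOrderAt (fun t => ∑ k ∈ s, q k t) z := by
  classical
  induction s using Finset.induction_on with
  | empty =>
    have : analyticOrderAt (fun _ : K => (0 : K)) z = ⊤ := by
      rw [analyticOrderAt_eq_top]
      exact Eventually.of_forall fun _ => rfl
    simp [this]
  | insert a s ha ih =>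
    simp only [Finset.sum_insert ha]
    exact (le_min (h a (by simp)) (ih fun k hk => h k (by simp [hk]))).trans le_analyticOrderAt_add

/-- If an analytic function vanishes near the origin on every line in a subspace, it vanishes
on the subspace near the origin. -/
lemma eventually_eq_zero_of_lines {K E : Type*} [NontriviallyNormedField K] [NormedAddCommGroup E]
    [NormedSpace K E] {f : E → K} (hf : AnalyticAt K f 0) (W : Submodule K E)
    (h : ∀ v ∈ W, ∀ᶠ t : K in 𝓝 0, f (t • v) = 0) : ∀ᶠ u in 𝓝 (0 : E), u ∈ W → f u = 0 := by
  obtain ⟨p, r, hp⟩ := hf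
  filter_upwards [Metric.eball_mem_nhds (0 : E) hp.r_pos] with u hu huW
  -- The value p_k(u, …, u) is the k-th coefficient of t ↦ f(t u), which is zero near t = 0.
  have hz : ∀ k, p k (fun _ => u) = 0 := by
    intro k
    let l : K →L[K] E := ContinuousLinearMap.toSpanSingleton K u
    have h1 : HasFPowerSeriesAt f p (l 0) := by simpa using hp.hasFPowerSeriesAt
    have h2 := h1.compContinuousLinearMap (u := l) (x := (0 : K))
    have h3 : HasFPowerSeriesAt (0 : K → K) (p.compContinuousLinearMap l) 0 :=
      h2.congr (by
        filter_upwards [h u huW] with t ht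
        simpa [l] using ht)
    have h4 : p k (fun _ => l 1) = 0 := h3.apply_eq_zero k 1
    simpa [l] using h4
  have h5 := hp.hasSum (y := u) (by simpa using hu)
  simp only [hz, zero_add] at h5
  exact h5.unique hasSum_zero

section

variable {K : Type*} [NontriviallyNormedField K] [IsUltrametricDist K] {n : ℕ}

lemma fderiv_zeroExt_apply (g : (Fin n → ValRing K) → ValRing K) (x : Fin n → ValRing K)
    (w : Fin n → K) :
    fderiv K (zeroExt g) (fun i => (x i : K)) w = gradAt g x ⬝ᵥ w :=
  clm_apply_eq_dotProduct _ w

/-- The local inverse of a system of analytic functions with nonzero Jacobian determinant. -/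
lemma exists_analytic_inverse [CompleteSpace K] (h : Fin n → (Fin n → ValRing K) → ValRing K)
    (P : Fin n → ValRing K)
    (hA : ∀ i, AnalyticAt K (zeroExt (h i)) (fun i => (P i : K)))
    (hdet : (Matrix.of fun i => gradAt (h i) P).det ≠ 0) :
    ∃ ψ : (Fin n → K) → (Fin n → K), AnalyticAt K ψ (fun i => (h i P : K)) ∧
      ψ (fun i => (h i P : K)) = (fun i => (P i : K)) ∧
      ∀ᶠ u in 𝓝 (fun i => (h i P : K)), ∀ i, zeroExt (h i) (ψ u) = u i := by
  let Φ : (Fin n → K) → (Fin n → K) := fun z i => zeroExt (h i) z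
  have hΦ : AnalyticAt K Φ (fun i => (P i : K)) := AnalyticAt.pi hA
  have hΦP : Φ (fun i => (P i : K)) = fun i => (h i P : K) := funext fun i => zeroExt_coe _ _
  have hL : ∀ w, fderiv K Φ (fun i => (P i : K)) w =
      (Matrix.of fun i => gradAt (h i) P).mulVec w := by
    intro w
    have h1 : HasFDerivAt Φ (ContinuousLinearMap.pi fun i =>
        fderiv K (zeroExt (h i)) (fun i => (P i : K))) (fun i => (P i : K)) :=
      hasFDerivAt_pi.2 fun i => (hA i).differentiableAt.hasFDerivAt
    rw [h1.fderiv]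
    ext i
    exact fderiv_zeroExt_apply _ _ _
  have hinj : Function.Injective (fderiv K Φ (fun i => (P i : K))).toLinearMap := by
    intro w w' hw
    have : (Matrix.of fun i => gradAt (h i) P).mulVec w =
        (Matrix.of fun i => gradAt (h i) P).mulVec w' := by
      rw [← hL, ← hL]
      exact hw
    exact Matrix.mulVec_injective_iff_isUnit.2
      ((Matrix.isUnit_iff_isUnit_det _).2 (isUnit_iff_ne_zero.2 hdet)) this
  let e : (Fin n → K) ≃L[K] (Fin n → K) :=
    (LinearEquiv.ofInjectiveEndo _ hinj).toContinuousLinearEquiv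
  have he : fderiv K Φ (fun i => (P i : K)) = (e : (Fin n → K) →L[K] (Fin n → K)) := by
    ext w
    rfl
  have hs : HasStrictFDerivAt Φ (e : (Fin n → K) →L[K] (Fin n → K)) (fun i => (P i : K)) :=
    he ▸ hΦ.hasStrictFDerivAt
  refine ⟨hs.localInverse Φ e _, ?_, ?_, ?_⟩
  · rw [← hΦP]
    exact (hs.toOpenPartialHomeomorph Φ).analyticAt_symm' hs.mem_toOpenPartialHomeomorph_source
      hΦ he
  · rw [← hΦP]
    exact hs.localInverse_apply_image
  · rw [← hΦP]
    filter_upwards [hs.eventually_right_inverse] with u hu i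
    exact congr_fun hu i

end

/-! ### Vanishing along the submanifold h_i = h_i(P), i ∈ S -/

section

variable {K : Type*} [NontriviallyNormedField K] [IsUltrametricDist K] {n : ℕ}
  {A : Subring ((Fin n → ValRing K) → ValRing K)}

/-- Evaluation at a point, as a ring homomorphism to `K`. -/
noncomputable def evalHom (A : Subring ((Fin n → ValRing K) → ValRing K)) (x : Fin n → ValRing K) :
    A →+* K :=
  ((ValRing K).subtype.comp (Pi.evalRingHom (fun _ => ValRing K) x)).comp A.subtype

lemma evalHom_apply (x : Fin n → ValRing K) (a : A) : evalHom A x a = (a.1 x : K) := rfl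

/-- For the vector fields `E_k = ∑_j adj(J)_{jk} ∂_j` and a curve `γ` that the functions `h_i` map
to the line `u + t v`, one has `det J · (g ∘ γ)' = ∑_k v_k (E_k g) ∘ γ`. -/
lemma det_mul_deriv_comp {h : Fin n → (Fin n → ValRing K) → ValRing K}
    (hA : ∀ g ∈ A, ∀ x : Fin n → ValRing K, AnalyticAt K (zeroExt g) (fun i => (x i : K)))
    (J : Matrix (Fin n) (Fin n) A) (hh : ∀ i, h i ∈ A)
    (hJ : ∀ i j x, ((J i j).1 x : K) = gradAt (h i) x j)
    {γ : K → Fin n → K} {u v : Fin n → K} {s : K} (hγ : DifferentiableAt K γ s)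
    (hline : ∀ i, ∀ᶠ t in 𝓝 s, zeroExt (h i) (γ t) = u i + t * v i)
    (hγO : ∀ i, γ s i ∈ ValRing K)
    (g : A) (g' : Fin n → A) (hg' : ∀ j x, ((g' j).1 x : K) = gradAt g.1 x j) :
    zeroExt J.det.1 (γ s) * deriv (fun t => zeroExt g.1 (γ t)) s =
      ∑ k, v k * zeroExt (∑ j, J.adjugate j k * g' j : A).1 (γ s) := by
  let x : Fin n → ValRing K := fun i => ⟨γ s i, hγO i⟩
  have hx : γ s = fun i => (x i : K) := rfl
  have hchain : ∀ a ∈ A, HasDerivAt (fun t => zeroExt a (γ t)) (gradAt a x ⬝ᵥ deriv γ s) s := by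
    intro a ha
    have h1 : HasFDerivAt (zeroExt a) (fderiv K (zeroExt a) (fun i => (x i : K))) (γ s) :=
      (hA a ha x).differentiableAt.hasFDerivAt
    have h2 := h1.comp_hasDerivAt s hγ.hasDerivAt
    rwa [fderiv_zeroExt_apply] at h2
  have hev : ∀ a : A, zeroExt a.1 (γ s) = evalHom A x a := fun a => zeroExt_coe a.1 x
  simp only [hev]
  rw [(hchain g.1 g.2).deriv]
  let Jx : Matrix (Fin n) (Fin n) K := (evalHom A x).mapMatrix J
  have hJγ : Jx.mulVec (deriv γ s) = v := by
    ext i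
    have h1 := hchain (h i) (hh i)
    have h2 : HasDerivAt (fun t => zeroExt (h i) (γ t)) (v i) s := by
      refine HasDerivAt.congr_of_eventuallyEq ?_ (hline i)
      simpa using ((hasDerivAt_id s).mul_const (v i)).const_add (u i)
    rw [← h1.unique h2]
    simp only [Matrix.mulVec, Jx]
    congr 1
    ext j
    exact hJ i j x
  -- Cramer's rule solves J γ' = v without dividing by det J.
  have hadj : Jx.adjugate.mulVec v = Jx.det • deriv γ s := by
    rw [← hJγ, Matrix.mulVec_mulVec, Matrix.adjugate_mul, Matrix.smul_mulVec, Matrix.one_mulVec]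
  have hgrad : gradAt g.1 x = fun j => evalHom A x (g' j) := funext fun j => (hg' j x).symm
  have hadjx : ∀ j k, evalHom A x (J.adjugate j k) = Jx.adjugate j k := by
    intro j k
    rw [← RingHom.map_adjugate]
    rfl
  rw [RingHom.map_det, ← smul_eq_mul, ← dotProduct_smul]
  change _ ⬝ᵥ (Jx.det • _) = _
  rw [← hadj, hgrad]
  simp only [map_sum, map_mul, hadjx, dotProduct, Matrix.mulVec, Finset.mul_sum]
  rw [Finset.sum_comm]
  exact Finset.sum_congr rfl fun k _ => Finset.sum_congr rfl fun j _ => by ring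

/-- Let `A` be a ring of analytic functions closed under partial derivatives and let `h_1, …, h_n`
be local coordinates at `P` from `A`. If the gradients at `P` of the functions of `A` vanishing at
`P` are spanned by those of the `h_i` with `i ∈ S`, then all functions of `A` that vanish at `P`
vanish near `P` where `h_i = h_i(P)` for all `i ∈ S`. -/
lemma eventually_eq_zero_of_gradient_mem_span [CompleteSpace K] [CharZero K]
    (hA : ∀ g ∈ A, ∀ x : Fin n → ValRing K, AnalyticAt K (zeroExt g) (fun i => (x i : K)))
    (hD : ∀ g ∈ A, ∀ j, ∃ g' ∈ A, ∀ x, (g' x : K) = gradAt g x j)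
    {h : Fin n → (Fin n → ValRing K) → ValRing K} (hh : ∀ i, h i ∈ A) (P : Fin n → ValRing K)
    (hdet : (Matrix.of fun i => gradAt (h i) P).det ≠ 0) (S : Set (Fin n))
    (hspan : ∀ g ∈ A, g P = 0 →
      gradAt g P ∈ Submodule.span K ((fun i => gradAt (h i) P) '' S))
    {ψ : (Fin n → K) → (Fin n → K)} (hψ : AnalyticAt K ψ (fun i => (h i P : K)))
    (hψP : ψ (fun i => (h i P : K)) = (fun i => (P i : K)))
    (hψh : ∀ᶠ u in 𝓝 (fun i => (h i P : K)), ∀ i, zeroExt (h i) (ψ u) = u i)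
    {f : (Fin n → ValRing K) → ValRing K} (hf : f ∈ A) (hfP : f P = 0) :
    ∀ᶠ u in 𝓝 (fun i => (h i P : K)), (∀ i ∈ S, u i = (h i P : K)) → zeroExt f (ψ u) = 0 := by
  choose D hDA hD using hD
  let D' : A → Fin n → A := fun g j => ⟨D g.1 g.2 j, hDA _ _ _⟩
  have hD' : ∀ (g : A) j x, ((D' g j).1 x : K) = gradAt g.1 x j := fun g j x => hD g.1 g.2 j x
  let J : Matrix (Fin n) (Fin n) A := Matrix.of fun i j => D' ⟨h i, hh i⟩ j
  have hJ : ∀ i j x, ((J i j).1 x : K) = gradAt (h i) x j := fun i j x => hD' _ _ _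
  have hJP : (evalHom A P).mapMatrix J = Matrix.of fun i => gradAt (h i) P := by
    ext i j
    exact hJ i j P
  -- E g k is det J · ∂g/∂h_k in the coordinates h; the adjugate keeps it inside A.
  let E : A → Fin n → A := fun g k => ∑ j, J.adjugate j k * D' g j
  -- Column k of the adjugate is orthogonal to the rows of J other than the k-th, hence to grad h_i
  -- for every i ∈ S, and so to grad g at P.
  have hE : ∀ (g : A) (k : Fin n), k ∉ S → g.1 P = 0 → (E g k).1 P = 0 := by
    intro g k hk hg
    let c : Fin n → K := fun j => ((evalHom A P).mapMatrix J).adjugate j k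
    have hc : gradAt g.1 P ⬝ᵥ c = 0 := by
      have hle : Submodule.span K ((fun i => gradAt (h i) P) '' S) ≤
          LinearMap.ker ((dotProductBilin K K : (Fin n → K) →ₗ[K] _).flip c) := by
        rw [Submodule.span_le]
        rintro _ ⟨i, hi, rfl⟩
        have h1 := congr_fun (congr_fun (Matrix.mul_adjugate ((evalHom A P).mapMatrix J)) i) k
        have hik : i ≠ k := fun h => hk (h ▸ hi)
        rw [Matrix.smul_apply, Matrix.one_apply_ne hik, smul_zero] at h1
        change gradAt (h i) P ⬝ᵥ c = 0
        rw [← h1, Matrix.mul_apply]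
        exact Finset.sum_congr rfl fun j _ => congr_arg (· * c j) (hJ i j P).symm
      have := hle (hspan g.1 g.2 hg)
      simpa using this
    have : evalHom A P (E g k) = 0 := by
      rw [← hc]
      simp only [E, map_sum, map_mul, dotProduct, c]
      refine Finset.sum_congr rfl fun j _ => ?_
      rw [mul_comm, ← RingHom.map_adjugate]
      congr 1
      exact hD' g j P
    rw [evalHom_apply] at this
    exact_mod_cast this
  let W : Submodule K (Fin n → K) :=
    { carrier := {v | ∀ i ∈ S, v i = 0}
      add_mem' := fun {a b} ha hb i hi => by simp [ha i hi, hb i hi]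
      zero_mem' := fun i _ => rfl
      smul_mem' := fun c a ha i hi => by simp [ha i hi] }
  let u₀ : Fin n → K := fun i => (h i P : K)
  have hlines : ∀ v ∈ W, ∀ g : A, g.1 P = 0 →
      ∀ᶠ t : K in 𝓝 0, zeroExt g.1 (ψ (u₀ + t • v)) = 0 := by
    intro v hv
    let γ : K → Fin n → K := fun t => ψ (u₀ + t • v)
    have hl : AnalyticAt K (fun t : K => u₀ + t • v) 0 := by fun_prop
    have hl0 : u₀ + (0 : K) • v = u₀ := by simp
    have hγ : AnalyticAt K γ 0 := AnalyticAt.fun_comp (by rw [hl0]; exact hψ) hl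
    have hγ0 : γ 0 = fun i => (P i : K) := by
      simp only [γ, hl0]
      exact hψP
    have hq : ∀ g : A, AnalyticAt K (fun t => zeroExt g.1 (γ t)) 0 := fun g =>
      AnalyticAt.fun_comp (by rw [hγ0]; exact hA g.1 g.2 P) hγ
    have hlt : Tendsto (fun t : K => u₀ + t • v) (𝓝 0) (𝓝 u₀) := by
      have := hl.continuousAt.tendsto
      rwa [hl0] at this
    have hγt : Tendsto γ (𝓝 0) (𝓝 fun i => (P i : K)) := hγ0 ▸ hγ.continuousAt.tendsto
    have hkey : ∀ g : A, ∀ᶠ t in 𝓝 (0 : K),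
        zeroExt J.det.1 (γ t) * deriv (fun t => zeroExt g.1 (γ t)) t =
          ∑ k, v k * zeroExt (E g k).1 (γ t) := by
      intro g
      filter_upwards [hγ.eventually_analyticAt, (hlt.eventually hψh).eventually_nhds,
        hγt.eventually (eventually_mem_valRing P)] with s hs1 hs2 hs3
      exact det_mul_deriv_comp hA J hh hJ hs1.differentiableAt
        (fun i => hs2.mono fun t ht => by simpa [γ, u₀] using ht i) hs3 g (D' g) (hD' g)
    -- Since det J is nonzero at P, multiplying by it does not change orders of vanishing.
    have hdet0 : analyticOrderAt (fun t => zeroExt J.det.1 (γ t)) 0 = 0 := by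
      rw [(hq _).analyticOrderAt_eq_zero, hγ0, zeroExt_coe]
      change evalHom A P J.det ≠ 0
      rwa [RingHom.map_det, hJP]
    -- The induction is over all g at once, since its step replaces g by the functions E g k, k ∉ S;
    -- the terms with k ∈ S drop out because v_k = 0.
    have hord : ∀ (N : ℕ) (g : A), g.1 P = 0 →
        (N : ℕ∞) ≤ analyticOrderAt (fun t => zeroExt g.1 (γ t)) 0 := by
      intro N
      induction N with
      | zero => simp
      | succ N ih =>
        intro g hg
        have h1 : (N : ℕ∞) ≤ analyticOrderAt (fun t => ∑ k, v k * zeroExt (E g k).1 (γ t)) 0 := by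
          refine natCast_le_analyticOrderAt_sum _ (fun k t => v k * zeroExt (E g k).1 (γ t)) _ _
            fun k _ => ?_
          by_cases hk : k ∈ S
          · rw [analyticOrderAt_eq_top.2]
            · exact le_top
            · simp [hv k hk]
          · have := analyticOrderAt_mul (f := fun _ : K => v k) analyticAt_const (hq (E g k))
            refine ((ih _ (hE g k hk hg)).trans le_add_self).trans this.ge
        rw [← analyticOrderAt_congr (hkey g)] at h1
        have h2 := analyticOrderAt_mul (hq J.det) (hq g).deriv
        have h3 : (N : ℕ∞) ≤ analyticOrderAt (deriv fun t => zeroExt g.1 (γ t)) 0 := by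
          rw [hdet0, zero_add] at h2
          exact h1.trans h2.le
        -- Characteristic zero enters here: differentiation lowers the order of a function vanishing
        -- at 0 by exactly one.
        have h4 := (hq g).analyticOrderAt_deriv_add_one
        simp only [hγ0, zeroExt_coe, hg, ZeroMemClass.coe_zero, sub_zero] at h4
        rw [← h4]
        push_cast
        gcongr
    intro g hg
    rw [← analyticOrderAt_eq_top]
    exact ENat.eq_top_iff_forall_ge.2 fun N => hord N g hg
  have han : AnalyticAt K (fun y => zeroExt f (ψ (u₀ + y))) 0 := by
    have h0 : AnalyticAt K (fun y : Fin n → K => u₀ + y) 0 := by fun_prop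
    have h1 : AnalyticAt K (fun y => ψ (u₀ + y)) 0 :=
      AnalyticAt.fun_comp (by rw [add_zero]; exact hψ) h0
    refine AnalyticAt.fun_comp (g := zeroExt f) ?_ h1
    rw [add_zero, hψP]
    exact hA f hf P
  have hz := eventually_eq_zero_of_lines han W fun v hv => hlines v hv ⟨f, hf⟩ hfP
  have htr : Tendsto (fun u : Fin n → K => u - u₀) (𝓝 u₀) (𝓝 0) := by
    have : Continuous fun u : Fin n → K => u - u₀ := by fun_prop
    simpa using this.tendsto u₀
  filter_upwards [htr.eventually hz] with u hu hS
  have := hu fun i hi => by simp [u₀, hS i hi]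
  simpa using this

end

/-! ### Completing a basis of a span by standard vectors -/

/-- A family of vectors of `K^n` has a basis of its span that is completed to a basis of `K^n` by
standard basis vectors. -/
lemma exists_basis_completion {K ι : Type*} [Field K] {n : ℕ} (w : ι → Fin n → K) :
    ∃ c : Fin n → ι ⊕ Fin n,
      LinearIndependent K (fun i => Sum.elim w (fun j => Pi.single j 1) (c i)) ∧
      ∀ a, w a ∈ Submodule.span K
        ((fun i => Sum.elim w (fun j => Pi.single j 1) (c i)) '' {i | (c i).isLeft}) := by
  let v : ι ⊕ Fin n → Fin n → K := Sum.elim w fun j => Pi.single j 1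
  -- First a basis b₀ of the span of w alone, then an extension of it: this makes the members of w
  -- that are kept span all of w.
  obtain ⟨b₀, hb₀, -, hsp₀, hli₀⟩ := exists_linearIndepOn_extension (K := K) (v := v) (s := ∅)
    (t := Set.range Sum.inl) (linearIndepOn_empty K v) (Set.empty_subset _)
  obtain ⟨b, hb, hb₀b, hsp, hli⟩ := exists_linearIndepOn_extension (K := K) (v := v) (s := b₀)
    (t := b₀ ∪ Set.range Sum.inr) hli₀ Set.subset_union_left
  have htop : ⊤ ≤ Submodule.span K (Set.range fun x : b => v x) := by
    have : Set.range (fun x : b => v x) = v '' b := by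
      rw [Set.image_eq_range]
    rw [this]
    intro z _
    have hz : z = ∑ j, z j • Pi.single (M := fun _ => K) j 1 := by
      ext i
      simp [Finset.sum_apply, Pi.single_apply]
    rw [hz]
    refine Submodule.sum_mem _ fun j _ => Submodule.smul_mem _ _ (hsp ?_)
    exact ⟨Sum.inr j, Or.inr ⟨j, rfl⟩, rfl⟩
  let B : Module.Basis b K (Fin n → K) := Module.Basis.mk hli htop
  have : Finite b := Module.Finite.finite_basis B
  have hcard : Nat.card b = n := by
    rw [← Module.finrank_eq_nat_card_basis B, Module.finrank_fin_fun]
  let e : Fin n ≃ b := (Finite.equivFinOfCardEq hcard).symm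
  refine ⟨fun i => (e i).1, hli.comp e e.injective, fun a => ?_⟩
  refine Submodule.span_mono ?_ (hsp₀ ⟨Sum.inl a, ⟨a, rfl⟩, rfl⟩)
  rintro _ ⟨s, hs, rfl⟩
  refine ⟨e.symm ⟨s, hb₀b hs⟩, ?_, by simp [v]⟩
  obtain ⟨a', rfl⟩ := hb₀ hs
  simp

/-! ### The ring of term functions and its constants -/

section

variable {K : Type*} [NontriviallyNormedField K] [IsUltrametricDist K]
  (F : (m : ℕ) → Set (ConvSeries K m)) {d : ℕ} (α : Fin d → ValRing K) (n : ℕ)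

/-- The ring of functions on `𝒪_K^n` defined by `L_F`-terms. -/
noncomputable def termFunSubring : Subring ((Fin n → ValRing K) → ValRing K) where
  carrier := Set.range fun t : (LangF F α).Term (Fin n) => termFun t
  zero_mem' := ⟨.func (FunSymb.zero : FunSymb F α 0) ![], rfl⟩
  one_mem' := ⟨.func (FunSymb.one : FunSymb F α 0) ![], rfl⟩
  neg_mem' := by
    rintro _ ⟨s, rfl⟩
    exact ⟨.func (FunSymb.neg : FunSymb F α 1) ![s], rfl⟩
  add_mem' := by
    rintro _ _ ⟨s, rfl⟩ ⟨t, rfl⟩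
    exact ⟨.func (FunSymb.add : FunSymb F α 2) ![s, t], rfl⟩
  mul_mem' := by
    rintro _ _ ⟨s, rfl⟩ ⟨t, rfl⟩
    exact ⟨.func (FunSymb.mul : FunSymb F α 2) ![s, t], rfl⟩

variable {F α n}

lemma termFun_mem_termFunSubring (t : (LangF F α).Term (Fin n)) :
    termFun t ∈ termFunSubring F α n :=
  ⟨t, rfl⟩

lemma coord_mem_termFunSubring (j : Fin n) :
    (fun x : Fin n → ValRing K => x j) ∈ termFunSubring F α n :=
  ⟨.var j, rfl⟩

lemma analyticAt_zeroExt_of_mem_termFunSubring [CompleteSpace K] :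
    ∀ g ∈ termFunSubring F α n, ∀ x : Fin n → ValRing K,
      AnalyticAt K (zeroExt g) (fun i => (x i : K)) := by
  rintro _ ⟨t, rfl⟩ x
  exact analyticAt_zeroExt_termFun t x

lemma deriv_coordSlice [CompleteSpace K] {g : (Fin n → ValRing K) → ValRing K}
    (hg : g ∈ termFunSubring F α n) (j : Fin n) (x : Fin n → ValRing K) :
    deriv (coordSlice g j x) (x j : K) = gradAt g x j :=
  (hasDerivAt_coordSlice (analyticAt_zeroExt_of_mem_termFunSubring g hg x) j).deriv

lemma exists_grad_mem_termFunSubring [CompleteSpace K] (hder : ClosedUnderDerivation F α) :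
    ∀ g ∈ termFunSubring F α n, ∀ j, ∃ g' ∈ termFunSubring F α n,
      ∀ x, (g' x : K) = gradAt g x j := by
  rintro _ ⟨t, rfl⟩ j
  obtain ⟨t', ht'⟩ := hder n t j
  refine ⟨termFun t', ⟨t', rfl⟩, fun x => ?_⟩
  rw [← deriv_coordSlice ⟨t, rfl⟩]
  exact (ht' x).deriv.symm

/-- The constants defined by `L_F`-terms are dense in `𝒪_K`. -/
lemma exists_const_mem_termFunSubring (p : ℕ) [Fact p.Prime] [NormedAlgebra ℚ_[p] K]
    (hα : IsIntegralBasis p α) (y : ValRing K) {ε : ℝ} (hε : 0 < ε) :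
    ∃ c : ValRing K, (fun _ => c) ∈ termFunSubring F α n ∧ ‖(c : K) - y‖ < ε := by
  obtain ⟨b, hb, hint⟩ := hα
  let C : Subring (ValRing K) :=
    (termFunSubring F α n).comap (Pi.constRingHom (Fin n → ValRing K) (ValRing K))
  have hαC : ∀ i, α i ∈ C := fun i => ⟨.func (FunSymb.const i : FunSymb F α 0) ![], rfl⟩
  -- The coordinates of y lie in ℤ_p, where ℤ is dense.
  have happrox : ∀ i, ∃ k : ℤ, ‖(b.repr (y : K) i) - k‖ ≤ ε / 2 := by
    intro i
    let z : ℤ_[p] := ⟨b.repr (y : K) i, hint y i⟩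
    obtain ⟨k, hk⟩ := PadicInt.denseRange_intCast.exists_dist_lt z (half_pos hε)
    rw [dist_eq_norm, PadicInt.norm_def, PadicInt.coe_sub, PadicInt.coe_intCast] at hk
    exact ⟨k, hk.le⟩
  choose k hk using happrox
  refine ⟨∑ i, (k i : ValRing K) * α i, ?_, ?_⟩
  · have : ∑ i, (k i : ValRing K) * α i ∈ C :=
      sum_mem fun i _ => mul_mem (intCast_mem _ _) (hαC i)
    exact this
  · have hy : (y : K) = ∑ i, b.repr (y : K) i • (α i : K) := by
      simp only [← hb]
      exact (b.sum_repr _).symm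
    rw [← norm_neg, neg_sub]
    conv_lhs => rw [hy]
    push_cast
    rw [← Finset.sum_sub_distrib]
    refine (IsUltrametricDist.norm_sum_le_of_forall_le_of_nonneg (half_pos hε).le
      fun i _ => ?_).trans_lt (half_lt_self hε)
    have : b.repr (y : K) i • (α i : K) - (k i : K) * α i = (b.repr (y : K) i - k i) • (α i : K) := by
      rw [sub_smul, Algebra.smul_def ((k i : ℤ) : ℚ_[p]), map_intCast]
    rw [this, norm_smul]
    exact (mul_le_of_le_one_right (norm_nonneg _) (mem_valRing_iff.1 (α i).2)).trans (hk i)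

end

/-! ### Gradients and Jacobians of the chosen functions -/

section

variable {K : Type*} [NontriviallyNormedField K] [IsUltrametricDist K] {n : ℕ}

lemma gradAt_coord (j : Fin n) (x : Fin n → ValRing K) :
    gradAt (fun y : Fin n → ValRing K => y j) x = Pi.single j 1 := by
  have h1 : zeroExt (fun y : Fin n → ValRing K => y j) =ᶠ[𝓝 fun i => (x i : K)] fun z => z j := by
    filter_upwards [eventually_mem_valRing x] with z hz
    rw [zeroExt_of_mem _ hz]
  ext k
  rw [gradAt, h1.fderiv_eq]
  have h2 : HasFDerivAt (fun z : Fin n → K => z j)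
      (ContinuousLinearMap.proj (R := K) (φ := fun _ : Fin n => K) j) (fun i => (x i : K)) :=
    (ContinuousLinearMap.proj (R := K) (φ := fun _ : Fin n => K) j).hasFDerivAt
  rw [h2.fderiv, ContinuousLinearMap.proj_apply, Pi.single_apply, Pi.single_apply]
  simp only [eq_comm]

lemma gradAt_sub_const (g : (Fin n → ValRing K) → ValRing K) (c : ValRing K)
    (x : Fin n → ValRing K) : gradAt (g - fun _ => c) x = gradAt g x := by
  have h1 : zeroExt (g - fun _ => c) =ᶠ[𝓝 fun i => (x i : K)] fun z => zeroExt g z - c := by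
    filter_upwards [eventually_mem_valRing x] with z hz
    simp [zeroExt_of_mem _ hz]
  ext k
  rw [gradAt, h1.fderiv_eq, fderiv_sub_const, gradAt]

/-- The determinant is a polynomial in the partial derivatives. Membership in A provides the
continuity by which it stays nonzero near P. -/
lemma exists_jacobian_det_mem {A : Subring ((Fin n → ValRing K) → ValRing K)}
    (hD : ∀ g ∈ A, ∀ j, ∃ g' ∈ A, ∀ x, (g' x : K) = gradAt g x j)
    {h : Fin n → (Fin n → ValRing K) → ValRing K} (hh : ∀ i, h i ∈ A) :
    ∃ δ ∈ A, ∀ x, (δ x : K) = (Matrix.of fun i => gradAt (h i) x).det := by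
  choose D hDA hD using fun i => hD (h i) (hh i)
  let J : Matrix (Fin n) (Fin n) A := Matrix.of fun i j => ⟨D i j, hDA i j⟩
  refine ⟨J.det.1, J.det.2, fun x => ?_⟩
  rw [← evalHom_apply, RingHom.map_det]
  congr 1
  ext i j
  exact hD i j x

end

/-! ### Moving the zero to a point with definable coordinates -/

theorem mainTheorem5 (p : ℕ) [Fact p.Prime] (K : Type*) [NontriviallyNormedField K]
    [IsUltrametricDist K] [NormedAlgebra ℚ_[p] K] [FiniteDimensional ℚ_[p] K]
    {d : ℕ} (α : Fin d → ValRing K) (hα : IsIntegralBasis p α)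
    (F : (m : ℕ) → Set (ConvSeries K m))
    (hder : ClosedUnderDerivation F α)
    (hnoeth : ∀ (n : ℕ) (T : Set ((LangF F α).Term (Fin n))), T.Finite →
      IsNoetherianRing (termRing T))
    (n : ℕ) (f : (LangF F α).Term (Fin n))
    (hf : ∃ x : Fin n → ValRing K, f.realize x = 0) :
    ∃ g : Fin n → (LangF F α).Term (Fin n), ∃ x : Fin n → ValRing K,
      f.realize x = 0 ∧ (∀ i, (g i).realize x = 0) ∧
        (jacobian (fun i => termFun (g i)) x).det ≠ 0 := by
  have : CompleteSpace K := FiniteDimensional.complete ℚ_[p] K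
  have : CharZero K := charZero_of_injective_algebraMap (algebraMap ℚ_[p] K).injective
  obtain ⟨P, hP⟩ := hf
  set A := termFunSubring F α n
  have hA := analyticAt_zeroExt_of_mem_termFunSubring (F := F) (α := α) (n := n)
  have hD := exists_grad_mem_termFunSubring (n := n) hder
  obtain ⟨c, hc, hcspan⟩ := exists_basis_completion
    fun a : {g // g ∈ A ∧ g P = 0} => gradAt a.1 P
  let toFun : {g // g ∈ A ∧ g P = 0} ⊕ Fin n → (Fin n → ValRing K) → ValRing K :=
    Sum.elim (fun a => a.1) fun j x => x j
  let h : Fin n → (Fin n → ValRing K) → ValRing K := fun i => toFun (c i)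
  have hmem : ∀ s, toFun s ∈ A := by
    rintro (a | j)
    · exact a.2.1
    · exact coord_mem_termFunSubring j
  have hh : ∀ i, h i ∈ A := fun i => hmem _
  have hgrad : (fun i => gradAt (h i) P) = fun i =>
      Sum.elim (fun a : {g // g ∈ A ∧ g P = 0} => gradAt a.1 P) (fun j => Pi.single j 1) (c i) := by
    have : ∀ s, gradAt (toFun s) P = Sum.elim (fun a : {g // g ∈ A ∧ g P = 0} => gradAt a.1 P)
        (fun j => Pi.single j 1) s := by
      rintro (a | j)
      · rfl
      · exact gradAt_coord j P
    exact funext fun i => this _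
  rw [← hgrad] at hc hcspan
  have hdet : (Matrix.of fun i => gradAt (h i) P).det ≠ 0 := by
    rw [← isUnit_iff_ne_zero, ← Matrix.isUnit_iff_isUnit_det]
    exact Matrix.linearIndependent_rows_iff_isUnit.1 hc
  let S : Set (Fin n) := {i | (c i).isLeft}
  have hS0 : ∀ i ∈ S, h i P = 0 := by
    have : ∀ s : {g // g ∈ A ∧ g P = 0} ⊕ Fin n, s.isLeft → toFun s P = 0 := by
      rintro (a | j) hs
      · exact a.2.2
      · simp at hs
    exact fun i hi => this _ hi
  obtain ⟨ψ, hψ, hψP, hψh⟩ := exists_analytic_inverse h P (fun i => hA _ (hh i) P) hdet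
  have hfz := eventually_eq_zero_of_gradient_mem_span hA hD hh P hdet S
    (fun g hg hgP => hcspan ⟨g, hg, hgP⟩) hψ hψP hψh (termFun_mem_termFunSubring f) hP
  obtain ⟨δ, hδA, hδ⟩ := exists_jacobian_det_mem hD hh
  have hψt : Tendsto ψ (𝓝 fun i => (h i P : K)) (𝓝 fun i => (P i : K)) :=
    hψP ▸ hψ.continuousAt.tendsto
  have hδne : ∀ᶠ z in 𝓝 (fun i => (P i : K)), zeroExt δ z ≠ 0 := by
    refine (hA δ hδA P).continuousAt.eventually_ne ?_
    rwa [zeroExt_coe, hδ]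
  obtain ⟨ε, hε, hball⟩ := Metric.eventually_nhds_iff.1 (hfz.and (hψh.and
    ((hψt.eventually (eventually_mem_valRing P)).and (hψt.eventually hδne))))
  -- For i ∈ S the value must be kept exactly, to remain on the submanifold, and it is 0; for the
  -- other i a nearby definable constant is enough.
  have hconst : ∀ i, ∃ a : ValRing K, (fun _ => a) ∈ A ∧ ‖(a : K) - h i P‖ < ε ∧
      (i ∈ S → a = h i P) := by
    intro i
    by_cases hi : i ∈ S
    · refine ⟨0, A.zero_mem, ?_, fun _ => (hS0 i hi).symm⟩
      simpa [hS0 i hi] using hε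
    · obtain ⟨a, ha, ha'⟩ := exists_const_mem_termFunSubring (F := F) (n := n) p hα (h i P) hε
      exact ⟨a, ha, ha', fun h => absurd h hi⟩
  choose a haA hadist haS using hconst
  obtain ⟨h1, h2, h3, h4⟩ := hball (y := fun i => (a i : K))
    ((dist_pi_lt_iff hε).2 fun i => by rw [dist_eq_norm]; exact hadist i)
  -- The point with coordinates h_i = a_i, obtained from the local inverse ψ.
  let x : Fin n → ValRing K := fun i => ⟨_, h3 i⟩
  have hx : ψ (fun i => (a i : K)) = fun i => (x i : K) := rfl
  have hga : ∀ i, h i - (fun _ => a i) ∈ A := fun i => A.sub_mem (hh i) (haA i)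
  choose g hg using hga
  refine ⟨g, x, ?_, fun i => ?_, ?_⟩
  · have := h1 fun i hi => by rw [haS i hi]
    rw [hx, zeroExt_coe] at this
    exact_mod_cast this
  · have h5 : h i x = a i := by
      have := h2 i
      rw [hx, zeroExt_coe] at this
      exact_mod_cast this
    change termFun (g i) x = 0
    rw [show termFun (g i) = _ from hg i, Pi.sub_apply, h5, sub_self]
  · have : jacobian (fun i => termFun (g i)) x = Matrix.of fun i => gradAt (h i) x := by
      ext i j
      change deriv (coordSlice (termFun (g i)) j x) (x j : K) = gradAt (h i) x j
      rw [deriv_coordSlice (termFun_mem_termFunSubring (g i)), show termFun (g i) = _ from hg i,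
        gradAt_sub_const]
    rw [this, ← hδ, ← zeroExt_coe δ x, ← hx]
    exact h4
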